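/- For a real number $q>0$ and $x>0$ let $\ln_q x=\int_1^x t^{q-2}\,dt$, that is, $\ln_q x=\frac{x^{q-1}-1}{q-1}$ if $q\ne 1$ and $\ln_1 x=\ln x$. A state is a positive semidefinite complex matrix of trace one. The Tsallis entropy of a state $\rho$ on a finite-dimensional Hilbert space is $S_q(\rho)=-\operatorname{Tr}\rho\ln_q\rho$, with the convention $0\ln_q 0=0$. For $q=1$ it is the von Neumann entropy $-\operatorname{Tr}\rho\log\rho$. For a state $\rho_{123}$ on $H_1\otimes H_2\otimes H_3$ let $\rho_{12},\rho_{23},\rho_2$ be its reduced states (partial traces) on $H_1\otimes H_2$, $H_2\otimes H_3$ and $H_2$. We say that $S_q$ is strongly subadditive if $$S_q(\rho_{123})+S_q(\rho_2)\le S_q(\rho_{12})+S_q(\rho_{23})\qquad(*)$$ for all finite-dimensional $H_1,H_2,H_3$ and all states $\rho_{123}$ on $H_1\otimes H_2\otimes H_3$. **Proposition.** Let $q>0$. Then $S_q$ is strongly subadditive if and only if $q=1$; thus the only strongly subadditive Tsallis entropy is the von Neumann entropy. More precisely: 1. For every $q>0$ and all states $\rho_X,\rho_Y$ on finite-dimensional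 spaces, $S_q(\rho_X\otimes\rho_Y)=S_q(\rho_X)+S_q(\rho_Y)+(1-q)S_q(\rho_X)S_q(\rho_Y)$. If $0<q<1$, then $(*)$ fails for some product state $\rho_{123}=\rho_1\otimes\rho_2\otimes\rho_3$ on $\mathbb C^2\otimes\mathbb C^2\otimes\mathbb C^2$. 2. On $\mathbb C^2\otimes\mathbb C^2\otimes\mathbb C^2$ with the lexicographically ordered product basis, consider $$\rho_{123}=\begin{pmatrix}0&0&0&0&0&0&0&0\\0&0&0&0&0&0&0&0\\0&0&\frac14&0&\frac14&0&0&0\\0&0&0&\frac14&0&\frac14&0&0\\0&0&\frac14&0&\frac14&0&0&0\\0&0&0&\frac14&0&\frac14&0&0\\0&0&0&0&0&0&0&0\\0&0&0&0&0&0&0&0\end{pmatrix}.$$ This is a state, its reduced state $\rho_{12}$ is pure and entangled (that is, not a convex combination of product states), and $(*)$ fails for it for every $q>1$. -/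

import Mathlib

open scoped Kronecker ComplexOrder

noncomputable section

/-- The deformed logarithm `ln_q x = ∫ t in 1..x, t ^ (q - 2)` in closed form, for `x > 0`. -/
def qLog (q x : ℝ) : ℝ :=
  if q = 1 then Real.log x else (x ^ (q - 1) - 1) / (q - 1)

/-- The function `Ln_q x = - x ln_q x`. The value at `x = 0` is `0`, which for `q > 0` is the
limit at `0` from the right. -/
def negMulQLog (q x : ℝ) : ℝ := -(x * qLog q x)

/-- A state of a finite-dimensional system, as a matrix in an orthonormal basis: positive
semidefinite with trace one. -/
def IsDensityMatrix {n : Type*} [Fintype n] (ρ : Matrix n n ℂ) : Prop :=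
  ρ.PosSemidef ∧ ρ.trace = 1

/-- The Tsallis entropy `S_q(ρ) = Tr Ln_q(ρ) = - Tr ρ ln_q ρ`, by functional calculus
(the trace is real for Hermitian `ρ`). -/
def tsallisEntropy {n : Type*} [Fintype n] [DecidableEq n] (q : ℝ) (ρ : Matrix n n ℂ) : ℝ :=
  (cfc (negMulQLog q) ρ).trace.re

/-- The von Neumann entropy `S(ρ) = - Tr ρ log ρ`, with `0 log 0 = 0`. -/
def vonNeumannEntropy {n : Type*} [Fintype n] [DecidableEq n] (ρ : Matrix n n ℂ) : ℝ :=
  -(ρ * cfc Real.log ρ).trace.re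

/-- The reduced matrix `ρ₁₂ = Tr₃ ρ₁₂₃`. -/
def reduced12 {n₁ n₂ n₃ : Type*} [Fintype n₃]
    (ρ : Matrix (n₁ × n₂ × n₃) (n₁ × n₂ × n₃) ℂ) : Matrix (n₁ × n₂) (n₁ × n₂) ℂ :=
  Matrix.of fun a b => ∑ k, ρ (a.1, a.2, k) (b.1, b.2, k)

/-- The reduced matrix `ρ₂₃ = Tr₁ ρ₁₂₃`. -/
def reduced23 {n₁ n₂ n₃ : Type*} [Fintype n₁]
    (ρ : Matrix (n₁ × n₂ × n₃) (n₁ × n₂ × n₃) ℂ) : Matrix (n₂ × n₃) (n₂ × n₃) ℂ :=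
  Matrix.of fun a b => ∑ i, ρ (i, a) (i, b)

/-- The reduced matrix `ρ₂ = Tr₁₃ ρ₁₂₃`. -/
def reduced2 {n₁ n₂ n₃ : Type*} [Fintype n₁] [Fintype n₃]
    (ρ : Matrix (n₁ × n₂ × n₃) (n₁ × n₂ × n₃) ℂ) : Matrix n₂ n₂ ℂ :=
  Matrix.of fun j j' => ∑ i, ∑ k, ρ (i, j, k) (i, j', k)

/-- The inequality `S_q(ρ₁₂₃) + S_q(ρ₂) ≤ S_q(ρ₁₂) + S_q(ρ₂₃)` for one tripartite matrix. -/
def SSAInequality {n₁ n₂ n₃ : Type*} [Fintype n₁] [Fintype n₂] [Fintype n₃]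
    [DecidableEq n₁] [DecidableEq n₂] [DecidableEq n₃]
    (q : ℝ) (ρ : Matrix (n₁ × n₂ × n₃) (n₁ × n₂ × n₃) ℂ) : Prop :=
  tsallisEntropy q ρ + tsallisEntropy q (reduced2 ρ) ≤
    tsallisEntropy q (reduced12 ρ) + tsallisEntropy q (reduced23 ρ)

/-- Strong subadditivity of `S_q`: the inequality holds for all finite-dimensional tripartite
states, in all dimensions. -/
def TsallisStronglySubadditive (q : ℝ) : Prop :=
  ∀ (d₁ d₂ d₃ : ℕ)
    (ρ : Matrix (Fin d₁ × Fin d₂ × Fin d₃) (Fin d₁ × Fin d₂ × Fin d₃) ℂ),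
    IsDensityMatrix ρ → SSAInequality q ρ

/-- A pure state: the projection `|ψ⟩⟨ψ|` onto a unit vector. -/
def IsPureState {n : Type*} [Fintype n] (ρ : Matrix n n ℂ) : Prop :=
  ∃ ψ : n → ℂ, star ψ ⬝ᵥ ψ = 1 ∧ ρ = Matrix.vecMulVec ψ (star ψ)

/-- A separable bipartite state: a convex combination of product states. -/
def IsSeparableState {m n : Type*} [Fintype m] [Fintype n]
    (ρ : Matrix (m × n) (m × n) ℂ) : Prop :=
  ρ ∈ convexHull ℝ {σ : Matrix (m × n) (m × n) ℂ |
    ∃ (α : Matrix m m ℂ) (β : Matrix n n ℂ),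
      IsDensityMatrix α ∧ IsDensityMatrix β ∧ σ = α ⊗ₖ β}

/-- An entangled bipartite state: a state that is not separable. -/
def IsEntangledState {m n : Type*} [Fintype m] [Fintype n]
    (ρ : Matrix (m × n) (m × n) ℂ) : Prop :=
  IsDensityMatrix ρ ∧ ¬ IsSeparableState ρ

/-- The position `4 i + 2 j + k` of the basis vector `e_i ⊗ e_j ⊗ e_k` of `ℂ² ⊗ ℂ² ⊗ ℂ²` in
the lexicographic order. -/
def tripleIndex (a : Fin 2 × Fin 2 × Fin 2) : Fin 8 :=
  ⟨4 * a.1.val + 2 * a.2.1.val + a.2.2.val, by omega⟩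

/-- The 8 × 8 counterexample, in the lexicographic product basis of `ℂ² ⊗ ℂ² ⊗ ℂ²`. -/
def counterexampleState : Matrix (Fin 2 × Fin 2 × Fin 2) (Fin 2 × Fin 2 × Fin 2) ℂ :=
  (!![0, 0, 0,     0,     0,     0,     0, 0;
      0, 0, 0,     0,     0,     0,     0, 0;
      0, 0, 1 / 4, 0,     1 / 4, 0,     0, 0;
      0, 0, 0,     1 / 4, 0,     1 / 4, 0, 0;
      0, 0, 1 / 4, 0,     1 / 4, 0,     0, 0;
      0, 0, 0,     1 / 4, 0,     1 / 4, 0, 0;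
      0, 0, 0,     0,     0,     0,     0, 0;
      0, 0, 0,     0,     0,     0,     0, 0] : Matrix (Fin 8) (Fin 8) ℂ).submatrix
    tripleIndex tripleIndex

end

/-!
The von Neumann entropy is strongly subadditive because the relative entropy
`D(ρ ‖ σ) = Tr ρ (log ρ - log σ)` decreases under partial traces: applied to `D(ρ₁₂₃ ‖ 1 ⊗ ρ₂₃)`
and the trace over the third factor, this reads `S(ρ₂) - S(ρ₁₂) ≤ S(ρ₂₃) - S(ρ₁₂₃)`.

Monotonicity of `D` has an elementary variational proof. With eigenvalues `pᵢ` of `ρ`, `sⱼ` of `σ`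
and overlaps `Wᵢⱼ` of the eigenbases, the sum `∑ |Wᵢⱼ|² pᵢ² / (sⱼ + t pᵢ)` is, for every `t ≥ 0`,
the maximum over all matrices `Y` of `Re (2 Tr ρ Y - Tr σ Y Y* - t Tr ρ Y* Y)`
(`Matrix.PosDef.resolventForm_le`, `Matrix.PosDef.exists_resolventForm_eq`). That expression only
involves expectations in `ρ` and `σ`, so passing to reduced matrices amounts to restricting `Y` to a
`*`-subalgebra, which lowers the maximum (`Matrix.PosDef.modularResolvent_le`). Integration over
`t ∈ [0, T]`, subtraction of `Tr ρ log T` and the limit `T → ∞` turn the sum into `D(ρ ‖ σ)`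
(`Matrix.PosDef.tendsto_modularResolventPrimitive`). Singular states are handled by adding `ε 1` and
letting `ε → 0` (`ssaInequality_one`); no normalization of the trace is needed.

For `q ≠ 1` the counterexamples rest on `S_q(ρ ⊗ σ) = S_q(ρ) + S_q(σ) + (1 - q) S_q(ρ) S_q(σ)`
(`tsallisEntropy_kronecker`). With `M` the maximally mixed qubit and `P` a pure one, the
inequality for `M ⊗ P ⊗ M` says `(1 - q) S_q(M)² ≤ 0`, which fails for `q < 1`. The explicit
`8 × 8` state is a maximally entangled pure state of the first two qubits times `M`,
and `ρ₂₃ = M ⊗ M`, so that the inequality says `0 ≤ (1 - q) S_q(M)²`, which fails for `q > 1`.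
Its reduction `ρ₁₂` is entangled since it violates a linear inequality that holds on all product
states (`IsSeparableState.two_mul_re_le`).
-/

/-! ### Spectral formulas for traces -/

namespace Matrix

section

variable {n : Type*} [Fintype n] [DecidableEq n]

theorem IsHermitian.cfc_eq_mul_diagonal_mul {A : Matrix n n ℂ} (hA : A.IsHermitian) (f : ℝ → ℝ) :
    cfc f A = (hA.eigenvectorUnitary : Matrix n n ℂ) *
      diagonal (fun i => (f (hA.eigenvalues i) : ℂ)) *
      (hA.eigenvectorUnitary : Matrix n n ℂ)ᴴ := by
  rw [hA.cfc_eq, IsHermitian.cfc, Unitary.conjStarAlgAut_apply]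
  rfl

theorem IsHermitian.eq_mul_diagonal_mul {A : Matrix n n ℂ} (hA : A.IsHermitian) :
    A = (hA.eigenvectorUnitary : Matrix n n ℂ) *
      diagonal (fun i => (hA.eigenvalues i : ℂ)) *
      (hA.eigenvectorUnitary : Matrix n n ℂ)ᴴ := by
  conv_lhs => rw [hA.spectral_theorem, Unitary.conjStarAlgAut_apply]
  rfl

theorem IsHermitian.eigenvectorUnitary_conjTranspose_mul {A : Matrix n n ℂ}
    (hA : A.IsHermitian) :
    (hA.eigenvectorUnitary : Matrix n n ℂ)ᴴ * (hA.eigenvectorUnitary : Matrix n n ℂ) = 1 :=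
  Unitary.coe_star_mul_self hA.eigenvectorUnitary

theorem IsHermitian.eigenvectorUnitary_mul_conjTranspose {A : Matrix n n ℂ}
    (hA : A.IsHermitian) :
    (hA.eigenvectorUnitary : Matrix n n ℂ) * (hA.eigenvectorUnitary : Matrix n n ℂ)ᴴ = 1 :=
  Unitary.coe_mul_star_self hA.eigenvectorUnitary

theorem IsHermitian.trace_cfc {A : Matrix n n ℂ} (hA : A.IsHermitian) (f : ℝ → ℝ) :
    (cfc f A).trace = ∑ i, (f (hA.eigenvalues i) : ℂ) := by
  rw [hA.cfc_eq_mul_diagonal_mul, trace_mul_comm, ← Matrix.mul_assoc,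
    hA.eigenvectorUnitary_conjTranspose_mul, Matrix.one_mul, trace_diagonal]

/-- The matrix of overlaps `⟨uᵢ, vⱼ⟩` between eigenbases `u` of `A` and `v` of `B`. -/
noncomputable def IsHermitian.overlap {A B : Matrix n n ℂ} (hA : A.IsHermitian)
    (hB : B.IsHermitian) : Matrix n n ℂ :=
  (hA.eigenvectorUnitary : Matrix n n ℂ)ᴴ * (hB.eigenvectorUnitary : Matrix n n ℂ)

theorem IsHermitian.trace_cfc_mul_cfc {A B : Matrix n n ℂ} (hA : A.IsHermitian)
    (hB : B.IsHermitian) (f g : ℝ → ℝ) :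
    (cfc f A * cfc g B).trace.re =
      ∑ i, ∑ j, ‖hA.overlap hB i j‖ ^ 2 * (f (hA.eigenvalues i) * g (hB.eigenvalues j)) := by
  rw [hA.cfc_eq_mul_diagonal_mul f, hB.cfc_eq_mul_diagonal_mul g]
  set U := (hA.eigenvectorUnitary : Matrix n n ℂ)
  set V := (hB.eigenvectorUnitary : Matrix n n ℂ)
  have h : (U * diagonal (fun i => (f (hA.eigenvalues i) : ℂ)) * Uᴴ *
      (V * diagonal (fun i => (g (hB.eigenvalues i) : ℂ)) * Vᴴ)).trace =
      (diagonal (fun i => (f (hA.eigenvalues i) : ℂ)) * hA.overlap hB *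
        (diagonal (fun i => (g (hB.eigenvalues i) : ℂ)) * (hA.overlap hB)ᴴ)).trace := by
    rw [IsHermitian.overlap, conjTranspose_mul, conjTranspose_conjTranspose]
    simp only [Matrix.mul_assoc]
    rw [trace_mul_comm]
    simp only [Matrix.mul_assoc]
    rfl
  rw [h, trace, Complex.re_sum]
  refine Finset.sum_congr rfl fun i _ => ?_
  rw [diag_apply, mul_apply, Complex.re_sum]
  refine Finset.sum_congr rfl fun j _ => ?_
  rw [diagonal_mul, diagonal_mul, conjTranspose_apply, ← Complex.normSq_eq_norm_sq,
    Complex.normSq_apply]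
  simp only [Complex.mul_re, Complex.mul_im, Complex.ofReal_re, Complex.ofReal_im,
    Complex.star_def, Complex.conj_re, Complex.conj_im]
  ring

/-! ### The resolvent of the relative modular operator as a maximum -/

/-- The quadratic form in `Y` whose maximum is `∑ i j, |Wᵢⱼ|² pᵢ² / (sⱼ + t pᵢ)`; it is linear
in the pair `(ρ, σ)`. -/
noncomputable def resolventForm (t : ℝ) (ρ σ Y : Matrix n n ℂ) : ℝ :=
  2 * (ρ * Y).trace.re - (σ * (Y * Yᴴ)).trace.re - t * (ρ * (Yᴴ * Y)).trace.re

theorem trace_diagonal_ofReal_mul_re (d : n → ℝ) (M : Matrix n n ℂ) :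
    (diagonal (fun i => (d i : ℂ)) * M).trace.re = ∑ i, d i * (M i i).re := by
  rw [trace, Complex.re_sum]
  refine Finset.sum_congr rfl fun i _ => ?_
  rw [diag_apply, diagonal_mul, Complex.re_ofReal_mul]

theorem IsHermitian.resolventForm_eq {ρ σ : Matrix n n ℂ} (hρ : ρ.IsHermitian)
    (hσ : σ.IsHermitian) (t : ℝ) (Z : Matrix n n ℂ) :
    resolventForm t ρ σ ((hσ.eigenvectorUnitary : Matrix n n ℂ) * Z *
        (hρ.eigenvectorUnitary : Matrix n n ℂ)ᴴ) =
      ∑ i, ∑ j, (2 * hρ.eigenvalues i * (hρ.overlap hσ i j * Z j i).re -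
        (hσ.eigenvalues j + t * hρ.eigenvalues i) * ‖Z j i‖ ^ 2) := by
  set U := (hρ.eigenvectorUnitary : Matrix n n ℂ) with hU
  set V := (hσ.eigenvectorUnitary : Matrix n n ℂ) with hV
  have hUU : Uᴴ * U = 1 := hρ.eigenvectorUnitary_conjTranspose_mul
  have hVV : Vᴴ * V = 1 := hσ.eigenvectorUnitary_conjTranspose_mul
  have hUU' (X : Matrix n n ℂ) : Uᴴ * (U * X) = X := by
    rw [← Matrix.mul_assoc, hUU, Matrix.one_mul]
  have hVV' (X : Matrix n n ℂ) : Vᴴ * (V * X) = X := by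
    rw [← Matrix.mul_assoc, hVV, Matrix.one_mul]
  set p : Matrix n n ℂ := diagonal (fun i => (hρ.eigenvalues i : ℂ)) with hp
  set s : Matrix n n ℂ := diagonal (fun i => (hσ.eigenvalues i : ℂ)) with hs
  have hρ' : ρ = U * p * Uᴴ := hρ.eq_mul_diagonal_mul
  have hσ' : σ = V * s * Vᴴ := hσ.eq_mul_diagonal_mul
  have h1 : (ρ * (V * Z * Uᴴ)).trace = (p * (hρ.overlap hσ * Z)).trace := by
    conv_lhs => rw [hρ']
    rw [IsHermitian.overlap]
    simp only [Matrix.mul_assoc]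
    rw [trace_mul_comm]
    simp only [Matrix.mul_assoc, hUU, Matrix.mul_one]
    rfl
  have h2 : (σ * ((V * Z * Uᴴ) * (V * Z * Uᴴ)ᴴ)).trace = (s * (Z * Zᴴ)).trace := by
    rw [hσ']
    simp only [conjTranspose_mul, conjTranspose_conjTranspose, Matrix.mul_assoc, hUU', hVV']
    rw [trace_mul_comm]
    simp only [Matrix.mul_assoc, hVV, Matrix.mul_one]
  have h3 : (ρ * ((V * Z * Uᴴ)ᴴ * (V * Z * Uᴴ))).trace = (p * (Zᴴ * Z)).trace := by
    rw [hρ']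
    simp only [conjTranspose_mul, conjTranspose_conjTranspose, Matrix.mul_assoc, hUU', hVV']
    rw [trace_mul_comm]
    simp only [Matrix.mul_assoc, hUU, Matrix.mul_one]
  have e1 : (p * (hρ.overlap hσ * Z)).trace.re =
      ∑ i, ∑ j, hρ.eigenvalues i * (hρ.overlap hσ i j * Z j i).re := by
    simp only [hp, trace_diagonal_ofReal_mul_re, mul_apply, Complex.re_sum, Finset.mul_sum]
  have e2 : (s * (Z * Zᴴ)).trace.re = ∑ i, ∑ j, hσ.eigenvalues j * ‖Z j i‖ ^ 2 := by
    rw [Finset.sum_comm]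
    simp only [hs, trace_diagonal_ofReal_mul_re, mul_apply, Complex.re_sum, Finset.mul_sum,
      conjTranspose_apply, Complex.star_def, Complex.mul_conj, Complex.ofReal_re,
      Complex.normSq_eq_norm_sq]
  have e3 : (p * (Zᴴ * Z)).trace.re = ∑ i, ∑ j, hρ.eigenvalues i * ‖Z j i‖ ^ 2 := by
    simp only [hp, trace_diagonal_ofReal_mul_re, mul_apply, Complex.re_sum, Finset.mul_sum,
      conjTranspose_apply, Complex.star_def, mul_comm (starRingEnd ℂ _), Complex.mul_conj,
      Complex.ofReal_re, Complex.normSq_eq_norm_sq]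
  rw [resolventForm, h1, h2, h3, e1, e2, e3]
  simp only [Finset.mul_sum, ← Finset.sum_sub_distrib]
  refine Finset.sum_congr rfl fun i _ => Finset.sum_congr rfl fun j _ => ?_
  ring

/-- The value `⟨ρ^{1/2}, (Δ + t)⁻¹ ρ^{1/2}⟩` of the resolvent of the relative modular operator
`Δ X = σ X ρ⁻¹`, written in eigenbases of `ρ` and `σ`. -/
noncomputable def IsHermitian.modularResolvent {ρ σ : Matrix n n ℂ} (hρ : ρ.IsHermitian)
    (hσ : σ.IsHermitian) (t : ℝ) : ℝ :=
  ∑ i, ∑ j, ‖hρ.overlap hσ i j‖ ^ 2 *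
    (hρ.eigenvalues i ^ 2 / (hσ.eigenvalues j + t * hρ.eigenvalues i))

theorem PosDef.resolventForm_le {ρ σ : Matrix n n ℂ} (hρ : ρ.PosDef) (hσ : σ.PosDef)
    {t : ℝ} (ht : 0 ≤ t) (Y : Matrix n n ℂ) :
    resolventForm t ρ σ Y ≤ hρ.isHermitian.modularResolvent hσ.isHermitian t := by
  set U := (hρ.isHermitian.eigenvectorUnitary : Matrix n n ℂ) with hU
  set V := (hσ.isHermitian.eigenvectorUnitary : Matrix n n ℂ) with hV
  have hY : Y = V * (Vᴴ * Y * U) * Uᴴ := by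
    simp only [Matrix.mul_assoc]
    rw [hρ.isHermitian.eigenvectorUnitary_mul_conjTranspose, Matrix.mul_one, ← Matrix.mul_assoc,
      hσ.isHermitian.eigenvectorUnitary_mul_conjTranspose, Matrix.one_mul]
  rw [hY, IsHermitian.resolventForm_eq, IsHermitian.modularResolvent]
  refine Finset.sum_le_sum fun i _ => Finset.sum_le_sum fun j _ => ?_
  set Z := Vᴴ * Y * U
  set w := hρ.isHermitian.overlap hσ.isHermitian i j
  have hp := hρ.eigenvalues_pos i
  have hs := hσ.eigenvalues_pos j
  set p := hρ.isHermitian.eigenvalues i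
  set s := hσ.isHermitian.eigenvalues j
  have hd : 0 < s + t * p := by positivity
  have h1 : (w * Z j i).re ≤ ‖w‖ * ‖Z j i‖ := (Complex.re_le_norm _).trans (norm_mul _ _).le
  have h2 : 2 * p * (w * Z j i).re ≤ 2 * p * (‖w‖ * ‖Z j i‖) :=
    mul_le_mul_of_nonneg_left h1 (by positivity)
  -- completing the square in `‖Z j i‖`
  have h3 : ‖w‖ ^ 2 * (p ^ 2 / (s + t * p)) - (2 * p * (‖w‖ * ‖Z j i‖) -
      (s + t * p) * ‖Z j i‖ ^ 2) = (p * ‖w‖ - (s + t * p) * ‖Z j i‖) ^ 2 / (s + t * p) := by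
    field_simp
    ring
  have h4 : 0 ≤ (p * ‖w‖ - (s + t * p) * ‖Z j i‖) ^ 2 / (s + t * p) := by positivity
  linarith

theorem PosDef.exists_resolventForm_eq {ρ σ : Matrix n n ℂ} (hρ : ρ.PosDef) (hσ : σ.PosDef)
    {t : ℝ} (ht : 0 ≤ t) :
    ∃ Y, resolventForm t ρ σ Y = hρ.isHermitian.modularResolvent hσ.isHermitian t := by
  -- the maximizer `pᵢ conj(Wᵢⱼ) / (sⱼ + t pᵢ)` of each summand, as a matrix in the eigenbases
  refine ⟨_, (hρ.isHermitian.resolventForm_eq hσ.isHermitian t (of fun j i =>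
    ((hρ.isHermitian.eigenvalues i / (hσ.isHermitian.eigenvalues j +
      t * hρ.isHermitian.eigenvalues i) : ℝ) : ℂ) *
      star (hρ.isHermitian.overlap hσ.isHermitian i j))).trans ?_⟩
  refine Finset.sum_congr rfl fun i _ => Finset.sum_congr rfl fun j _ => ?_
  set w := hρ.isHermitian.overlap hσ.isHermitian i j
  have hp := hρ.eigenvalues_pos i
  have hs := hσ.eigenvalues_pos j
  set p := hρ.isHermitian.eigenvalues i
  set s := hσ.isHermitian.eigenvalues j
  have hd : 0 < s + t * p := by positivity
  have h1 : (w * ((p / (s + t * p) : ℝ) * star w : ℂ)).re = p / (s + t * p) * ‖w‖ ^ 2 := by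
    rw [mul_left_comm, Complex.re_ofReal_mul, Complex.star_def, Complex.mul_conj,
      Complex.ofReal_re, Complex.normSq_eq_norm_sq]
  change 2 * p * (w * ((p / (s + t * p) : ℝ) * star w : ℂ)).re -
    (s + t * p) * ‖((p / (s + t * p) : ℝ) * star w : ℂ)‖ ^ 2 = ‖w‖ ^ 2 * (p ^ 2 / (s + t * p))
  rw [h1, norm_mul, norm_star, Complex.norm_real, mul_pow, Real.norm_eq_abs, sq_abs]
  field_simp
  ring

end

/-! ### Monotonicity of the relative entropy -/

section Monotonicity

variable {m n : Type*} [Fintype m] [DecidableEq m] [Fintype n] [DecidableEq n]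
  {ρ σ : Matrix n n ℂ} {ρ' σ' : Matrix m m ℂ}

/-- The resolvent decreases under restriction to a `*`-subalgebra: the quadratic form of the
restricted pair is the original form on the subalgebra, so its maximum is smaller. -/
theorem PosDef.modularResolvent_le (hρ : ρ.PosDef) (hσ : σ.PosDef) (hρ' : ρ'.PosDef)
    (hσ' : σ'.PosDef) (φ : Matrix m m ℂ →⋆ₐ[ℂ] Matrix n n ℂ)
    (hφρ : ∀ Y, (ρ * φ Y).trace = (ρ' * Y).trace)
    (hφσ : ∀ Y, (σ * φ Y).trace = (σ' * Y).trace) {t : ℝ} (ht : 0 ≤ t) :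
    hρ'.isHermitian.modularResolvent hσ'.isHermitian t ≤
      hρ.isHermitian.modularResolvent hσ.isHermitian t := by
  obtain ⟨Y, hY⟩ := hρ'.exists_resolventForm_eq hσ' ht
  rw [← hY]
  refine le_trans (le_of_eq ?_) (hρ.resolventForm_le hσ ht (φ Y))
  have h : (φ Y)ᴴ = φ Yᴴ := (map_star φ Y).symm
  rw [resolventForm, resolventForm, h, ← map_mul, ← map_mul, hφρ, hφρ, hφσ]

/-- The integral of `modularResolvent` over `[0, T]`. -/
noncomputable def IsHermitian.modularResolventPrimitive (hρ : ρ.IsHermitian)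
    (hσ : σ.IsHermitian) (T : ℝ) : ℝ :=
  ∑ i, ∑ j, ‖hρ.overlap hσ i j‖ ^ 2 * (hρ.eigenvalues i *
    (Real.log (hσ.eigenvalues j + T * hρ.eigenvalues i) - Real.log (hσ.eigenvalues j)))

theorem PosDef.hasDerivAt_modularResolventPrimitive (hρ : ρ.PosDef) (hσ : σ.PosDef)
    {T : ℝ} (hT : 0 ≤ T) :
    HasDerivAt (hρ.isHermitian.modularResolventPrimitive hσ.isHermitian)
      (hρ.isHermitian.modularResolvent hσ.isHermitian T) T := by
  unfold IsHermitian.modularResolventPrimitive IsHermitian.modularResolvent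
  refine HasDerivAt.fun_sum fun i _ => HasDerivAt.fun_sum fun j _ => ?_
  have hp := hρ.eigenvalues_pos i
  have hs := hσ.eigenvalues_pos j
  have hd : 0 < hσ.isHermitian.eigenvalues j + T * hρ.isHermitian.eigenvalues i := by positivity
  have h := ((((hasDerivAt_id' T).mul_const (hρ.isHermitian.eigenvalues i)).const_add
    (hσ.isHermitian.eigenvalues j)).log hd.ne').sub_const
      (Real.log (hσ.isHermitian.eigenvalues j))
  refine ((h.const_mul (hρ.isHermitian.eigenvalues i)).const_mul
    (‖hρ.isHermitian.overlap hσ.isHermitian i j‖ ^ 2)).congr_deriv ?_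
  ring

theorem PosDef.modularResolventPrimitive_le (hρ : ρ.PosDef) (hσ : σ.PosDef) (hρ' : ρ'.PosDef)
    (hσ' : σ'.PosDef) (φ : Matrix m m ℂ →⋆ₐ[ℂ] Matrix n n ℂ)
    (hφρ : ∀ Y, (ρ * φ Y).trace = (ρ' * Y).trace)
    (hφσ : ∀ Y, (σ * φ Y).trace = (σ' * Y).trace) {T : ℝ} (hT : 0 ≤ T) :
    hρ'.isHermitian.modularResolventPrimitive hσ'.isHermitian T ≤
      hρ.isHermitian.modularResolventPrimitive hσ.isHermitian T := by
  have hder (t : ℝ) (ht : 0 ≤ t) :=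
    (hρ.hasDerivAt_modularResolventPrimitive hσ ht).sub
      (hρ'.hasDerivAt_modularResolventPrimitive hσ' ht)
  have hmono := monotoneOn_of_deriv_nonneg (convex_Ici (0 : ℝ))
    (fun t ht => (hder t ht).continuousAt.continuousWithinAt)
    (fun t ht => (hder t (interior_subset ht)).differentiableAt.differentiableWithinAt)
    (fun t ht => by
      rw [(hder t (interior_subset ht)).deriv]
      exact sub_nonneg.2 (hρ.modularResolvent_le hσ hρ' hσ' φ hφρ hφσ (interior_subset ht)))
  have h := hmono (Set.self_mem_Ici) hT hT
  simp only [Pi.sub_apply, IsHermitian.modularResolventPrimitive, zero_mul, add_zero, sub_self,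
    mul_zero, Finset.sum_const_zero] at h ⊢
  linarith

open Filter Topology in
theorem PosDef.tendsto_modularResolventPrimitive (hρ : ρ.PosDef) (hσ : σ.PosDef) :
    Tendsto (fun T => hρ.isHermitian.modularResolventPrimitive hσ.isHermitian T -
        ρ.trace.re * Real.log T) atTop
      (𝓝 (-(cfc Real.negMulLog ρ).trace.re - (ρ * cfc Real.log σ).trace.re)) := by
  have hρ1 : cfc (fun x : ℝ => x) ρ = ρ := cfc_id' ℝ ρ hρ.isHermitian
  have hσ1 : cfc (fun _ : ℝ => (1 : ℝ)) σ = 1 := cfc_const_one ℝ σ hσ.isHermitian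
  have h1 := hρ.isHermitian.trace_cfc_mul_cfc hσ.isHermitian (fun x => x) (fun _ => 1)
  have h2 := hρ.isHermitian.trace_cfc_mul_cfc hσ.isHermitian Real.negMulLog (fun _ => 1)
  have h3 := hρ.isHermitian.trace_cfc_mul_cfc hσ.isHermitian (fun x => x) Real.log
  rw [hρ1, hσ1, Matrix.mul_one] at h1
  rw [hσ1, Matrix.mul_one] at h2
  rw [hρ1] at h3
  rw [h1, h2, h3]
  unfold IsHermitian.modularResolventPrimitive
  simp only [Finset.sum_mul, ← Finset.sum_sub_distrib, ← Finset.sum_neg_distrib]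
  refine tendsto_finsetSum _ fun i _ => tendsto_finsetSum _ fun j _ => ?_
  have hp := hρ.eigenvalues_pos i
  have hs := hσ.eigenvalues_pos j
  set w := ‖hρ.isHermitian.overlap hσ.isHermitian i j‖ ^ 2
  set p := hρ.isHermitian.eigenvalues i
  set s := hσ.isHermitian.eigenvalues j
  have hlim : Tendsto (fun T : ℝ => Real.log (s / T + p)) atTop (𝓝 (Real.log (0 + p))) :=
    ((tendsto_const_nhds.div_atTop tendsto_id).add_const p).log (by simpa using hp.ne')
  have hlim' : Tendsto (fun T : ℝ => w * (p * (Real.log (s / T + p) - Real.log s))) atTop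
      (𝓝 (w * (p * (Real.log (0 + p) - Real.log s)))) :=
    ((hlim.sub_const _).const_mul p).const_mul w
  have hval : w * (p * (Real.log (0 + p) - Real.log s)) =
      -(w * (Real.negMulLog p * 1)) - w * (p * Real.log s) := by
    rw [Real.negMulLog, zero_add]
    ring
  rw [← hval]
  refine hlim'.congr' ?_
  filter_upwards [eventually_gt_atTop 0] with T hT
  -- the weights `|Wᵢⱼ|² pᵢ` sum to `Tr ρ`, so `log T` can be subtracted inside each logarithm
  have : s / T + p = (s + T * p) / T := by field_simp
  rw [this, Real.log_div (by positivity) hT.ne']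
  ring

/-- Monotonicity of the relative entropy `Tr ρ (log ρ - log σ)` under restriction of `ρ` and `σ`
to a `*`-subalgebra, for positive definite matrices of arbitrary trace. -/
theorem PosDef.relativeEntropy_le (hρ : ρ.PosDef) (hσ : σ.PosDef) (hρ' : ρ'.PosDef)
    (hσ' : σ'.PosDef) (φ : Matrix m m ℂ →⋆ₐ[ℂ] Matrix n n ℂ)
    (hφρ : ∀ Y, (ρ * φ Y).trace = (ρ' * Y).trace)
    (hφσ : ∀ Y, (σ * φ Y).trace = (σ' * Y).trace) :
    -(cfc Real.negMulLog ρ').trace.re - (ρ' * cfc Real.log σ').trace.re ≤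
      -(cfc Real.negMulLog ρ).trace.re - (ρ * cfc Real.log σ).trace.re := by
  have htr : ρ.trace = ρ'.trace := by
    have h := hφρ 1
    rwa [map_one, Matrix.mul_one, Matrix.mul_one] at h
  refine le_of_tendsto_of_tendsto (hρ'.tendsto_modularResolventPrimitive hσ')
    (hρ.tendsto_modularResolventPrimitive hσ) ?_
  filter_upwards [Filter.eventually_ge_atTop 0] with T hT
  rw [htr]
  exact sub_le_sub_right (hρ.modularResolventPrimitive_le hσ hρ' hσ' φ hφρ hφσ hT) _

end Monotonicity

end Matrix

/-! ### Tensor factors, reduced matrices and the functional calculus -/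

namespace Matrix

/-- The embedding `X ↦ X ⊗ 1` of the matrices of a tensor factor, as a `*`-homomorphism. -/
def kroneckerOneHom (m n : Type*) [Fintype m] [DecidableEq m] [Fintype n] [DecidableEq n] :
    Matrix m m ℂ →⋆ₐ[ℂ] Matrix (m × n) (m × n) ℂ where
  toFun X := X ⊗ₖ 1
  map_one' := one_kronecker_one
  map_mul' X Y := by rw [← mul_kronecker_mul, Matrix.one_mul]
  map_zero' := zero_kronecker _
  map_add' X Y := add_kronecker X Y 1
  commutes' r := by
    rw [Algebra.algebraMap_eq_smul_one, smul_kronecker, one_kronecker_one,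
      Algebra.algebraMap_eq_smul_one]
  map_star' X := by simp [star_eq_conjTranspose, conjTranspose_kronecker]

/-- The embedding `X ↦ 1 ⊗ X` of the matrices of a tensor factor, as a `*`-homomorphism. -/
def oneKroneckerHom (m n : Type*) [Fintype m] [DecidableEq m] [Fintype n] [DecidableEq n] :
    Matrix n n ℂ →⋆ₐ[ℂ] Matrix (m × n) (m × n) ℂ where
  toFun X := 1 ⊗ₖ X
  map_one' := one_kronecker_one
  map_mul' X Y := by rw [← mul_kronecker_mul, Matrix.one_mul]
  map_zero' := kronecker_zero _
  map_add' X Y := kronecker_add 1 X Y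
  commutes' r := by
    rw [Algebra.algebraMap_eq_smul_one, kronecker_smul, one_kronecker_one,
      Algebra.algebraMap_eq_smul_one]
  map_star' X := by simp [star_eq_conjTranspose, conjTranspose_kronecker]

/-- Relabelling of the basis by an equivalence, as a `*`-homomorphism. -/
def reindexHom {m n : Type*} [Fintype m] [DecidableEq m] [Fintype n] [DecidableEq n]
    (e : m ≃ n) : Matrix m m ℂ →⋆ₐ[ℂ] Matrix n n ℂ where
  __ := (reindexAlgEquiv ℂ ℂ e).toAlgHom
  map_star' _ := rfl

theorem IsHermitian.cfc_add_smul_one {n : Type*} [Fintype n] [DecidableEq n]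
    {A : Matrix n n ℂ} (hA : A.IsHermitian) {f : ℝ → ℝ} (hf : Continuous f) (c : ℝ) :
    cfc f (A + c • (1 : Matrix n n ℂ)) = cfc (fun x => f (x + c)) A := by
  have h : cfc (fun x : ℝ => x + c) A = A + c • (1 : Matrix n n ℂ) := by
    have hA' : IsSelfAdjoint A := hA
    rw [cfc_add_const c (fun x => x) A, cfc_id' ℝ A, Algebra.algebraMap_eq_smul_one]
  rw [← h, ← cfc_comp' f (fun x => x + c) A]

theorem map_cfc_of_isHermitian {m n : Type*} [Fintype m] [DecidableEq m] [Fintype n]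
    [DecidableEq n] (φ : Matrix m m ℂ →⋆ₐ[ℂ] Matrix n n ℂ) (f : ℝ → ℝ) {A : Matrix m m ℂ}
    (hA : A.IsHermitian) : φ (cfc f A) = cfc f (φ A) := by
  have hA' : IsSelfAdjoint A := hA
  have hfin : (spectrum ℝ A).Finite := by
    rw [hA.spectrum_real_eq_range_eigenvalues]
    exact Set.finite_range _
  exact φ.map_cfc f A (hfin.continuousOn _)
    (LinearMap.continuous_of_finiteDimensional (φ : Matrix m m ℂ →ₗ[ℂ] Matrix n n ℂ))
    hA' (hA'.map φ)

theorem PosSemidef.add_smul_one_posDef {n : Type*} [Fintype n] [DecidableEq n]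
    {A : Matrix n n ℂ} (hA : A.PosSemidef) {c : ℝ} (hc : 0 < c) :
    (A + c • (1 : Matrix n n ℂ)).PosDef :=
  PosDef.posSemidef_add hA (PosDef.one.smul hc)

open Filter Topology in
theorem IsHermitian.tendsto_trace_cfc_add_smul_one {n : Type*} [Fintype n] [DecidableEq n]
    {A : Matrix n n ℂ} (hA : A.IsHermitian) {f : ℝ → ℝ} (hf : Continuous f) (c : ℝ) :
    Tendsto (fun ε : ℝ => (cfc f (A + (ε * c) • (1 : Matrix n n ℂ))).trace.re) (𝓝[>] 0)
      (𝓝 (cfc f A).trace.re) := by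
  have h (ε : ℝ) : (cfc f (A + (ε * c) • (1 : Matrix n n ℂ))).trace.re =
      ∑ i, f (hA.eigenvalues i + ε * c) := by
    rw [hA.cfc_add_smul_one hf, hA.trace_cfc, Complex.re_sum]
    rfl
  have h0 : (cfc f A).trace.re = ∑ i, f (hA.eigenvalues i + 0 * c) := by
    rw [hA.trace_cfc, Complex.re_sum]
    simp
  rw [h0]
  simp only [h]
  have hcont : Continuous fun ε : ℝ => ∑ i, f (hA.eigenvalues i + ε * c) := by fun_prop
  exact (hcont.tendsto 0).mono_left nhdsWithin_le_nhds

end Matrix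

open Matrix

section

variable {n₁ n₂ n₃ : Type*}

theorem trace_reduced12_mul [Fintype n₁] [Fintype n₂] [Fintype n₃]
    [DecidableEq n₁] [DecidableEq n₂] [DecidableEq n₃]
    (ρ : Matrix (n₁ × n₂ × n₃) (n₁ × n₂ × n₃) ℂ)
    (Y : Matrix (n₁ × n₂) (n₁ × n₂) ℂ) :
    (ρ * reindexHom (Equiv.prodAssoc n₁ n₂ n₃) (kroneckerOneHom (n₁ × n₂) n₃ Y)).trace =
      (reduced12 ρ * Y).trace := by
  have h (a b : n₁ × n₂ × n₃) :
      reindexHom (Equiv.prodAssoc n₁ n₂ n₃) (kroneckerOneHom (n₁ × n₂) n₃ Y) a b =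
        Y (a.1, a.2.1) (b.1, b.2.1) * (1 : Matrix n₃ n₃ ℂ) a.2.2 b.2.2 := rfl
  simp only [trace, diag_apply, mul_apply, h, reduced12, of_apply, Fintype.sum_prod_type,
    one_apply, mul_ite, mul_one, mul_zero, Finset.sum_ite_eq', Finset.mem_univ, if_true,
    Finset.sum_mul]
  refine Finset.sum_congr rfl fun i _ => Finset.sum_congr rfl fun j _ => ?_
  rw [Finset.sum_comm]
  refine Finset.sum_congr rfl fun i' _ => ?_
  rw [Finset.sum_comm]

theorem trace_reduced23_mul [Fintype n₁] [Fintype n₂] [Fintype n₃]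
    [DecidableEq n₁] [DecidableEq n₂] [DecidableEq n₃]
    (ρ : Matrix (n₁ × n₂ × n₃) (n₁ × n₂ × n₃) ℂ)
    (Y : Matrix (n₂ × n₃) (n₂ × n₃) ℂ) :
    (ρ * oneKroneckerHom n₁ (n₂ × n₃) Y).trace = (reduced23 ρ * Y).trace := by
  have h (a b : n₁ × n₂ × n₃) :
      oneKroneckerHom n₁ (n₂ × n₃) Y a b = (1 : Matrix n₁ n₁ ℂ) a.1 b.1 * Y a.2 b.2 := rfl
  have h' (i i' : n₁) (a b : n₂ × n₃) : (1 : Matrix n₁ n₁ ℂ) i i' * Y a b =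
    if i = i' then Y a b else 0 := by rw [one_apply, ite_mul, one_mul, zero_mul]
  simp only [trace, diag_apply, mul_apply, h, h', reduced23, of_apply,
    Fintype.sum_prod_type (α₁ := n₁), mul_ite, mul_zero, Finset.sum_mul]
  rw [Finset.sum_comm]
  refine Finset.sum_congr rfl fun a _ => ?_
  rw [Finset.sum_comm (s := (Finset.univ : Finset (n₂ × n₃)))]
  refine Finset.sum_congr rfl fun i _ => ?_
  rw [Finset.sum_comm]
  simp

theorem trace_reduced2_mul [Fintype n₁] [Fintype n₂] [Fintype n₃]
    [DecidableEq n₁] [DecidableEq n₂]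
    (ρ : Matrix (n₁ × n₂ × n₃) (n₁ × n₂ × n₃) ℂ)
    (Y : Matrix n₂ n₂ ℂ) :
    (reduced12 ρ * oneKroneckerHom n₁ n₂ Y).trace = (reduced2 ρ * Y).trace := by
  have h (a b : n₁ × n₂) :
      oneKroneckerHom n₁ n₂ Y a b = (1 : Matrix n₁ n₁ ℂ) a.1 b.1 * Y a.2 b.2 := rfl
  have h' (i i' : n₁) (a b : n₂) : (1 : Matrix n₁ n₁ ℂ) i i' * Y a b =
    if i = i' then Y a b else 0 := by rw [one_apply, ite_mul, one_mul, zero_mul]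
  simp only [trace, diag_apply, mul_apply, h, h', reduced12, reduced2, of_apply,
    Fintype.sum_prod_type (α₁ := n₁), mul_ite, mul_zero, Finset.sum_mul]
  rw [Finset.sum_comm]
  refine Finset.sum_congr rfl fun a _ => ?_
  rw [Finset.sum_comm (s := (Finset.univ : Finset n₂))]
  refine Finset.sum_congr rfl fun i _ => ?_
  rw [Finset.sum_comm]
  simp

theorem trace_oneKroneckerHom_reduced23_mul [Fintype n₁] [Fintype n₂] [Fintype n₃]
    [DecidableEq n₁] [DecidableEq n₂] [DecidableEq n₃]
    (ρ : Matrix (n₁ × n₂ × n₃) (n₁ × n₂ × n₃) ℂ)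
    (Y : Matrix (n₁ × n₂) (n₁ × n₂) ℂ) :
    (oneKroneckerHom n₁ (n₂ × n₃) (reduced23 ρ) *
        reindexHom (Equiv.prodAssoc n₁ n₂ n₃) (kroneckerOneHom (n₁ × n₂) n₃ Y)).trace =
      (oneKroneckerHom n₁ n₂ (reduced2 ρ) * Y).trace := by
  rw [trace_reduced12_mul]
  congr 2
  ext a b
  change ∑ k, (1 : Matrix n₁ n₁ ℂ) a.1 b.1 * ∑ i, ρ (i, a.2, k) (i, b.2, k) =
    (1 : Matrix n₁ n₁ ℂ) a.1 b.1 * ∑ i, ∑ k, ρ (i, a.2, k) (i, b.2, k)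
  rw [← Finset.mul_sum, Finset.sum_comm]

theorem Matrix.PosSemidef.reduced12 [Fintype n₃]
    {ρ : Matrix (n₁ × n₂ × n₃) (n₁ × n₂ × n₃) ℂ}
    (hρ : ρ.PosSemidef) : (reduced12 ρ).PosSemidef := by
  have h : _root_.reduced12 ρ = ∑ k,
      ρ.submatrix (fun a => (a.1, a.2, k)) (fun a => (a.1, a.2, k)) := by
    ext a b
    simp [_root_.reduced12, Matrix.sum_apply]
  rw [h]
  exact posSemidef_sum _ fun k _ => hρ.submatrix _

theorem Matrix.PosSemidef.reduced23 [Fintype n₁]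
    {ρ : Matrix (n₁ × n₂ × n₃) (n₁ × n₂ × n₃) ℂ}
    (hρ : ρ.PosSemidef) : (reduced23 ρ).PosSemidef := by
  have h : _root_.reduced23 ρ = ∑ i, ρ.submatrix (fun a => (i, a)) (fun a => (i, a)) := by
    ext a b
    simp [_root_.reduced23, Matrix.sum_apply]
  rw [h]
  exact posSemidef_sum _ fun k _ => hρ.submatrix _

theorem Matrix.PosSemidef.reduced2 [Fintype n₁] [Fintype n₃]
    {ρ : Matrix (n₁ × n₂ × n₃) (n₁ × n₂ × n₃) ℂ}
    (hρ : ρ.PosSemidef) : (reduced2 ρ).PosSemidef := by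
  have h : _root_.reduced2 ρ =
      ∑ i, ∑ k, ρ.submatrix (fun a => (i, a, k)) (fun a => (i, a, k)) := by
    ext a b
    simp [_root_.reduced2, Matrix.sum_apply]
  rw [h]
  exact posSemidef_sum _ fun i _ => posSemidef_sum _ fun k _ => hρ.submatrix _

theorem reduced12_add_smul_one [Fintype n₃]
    [DecidableEq n₁] [DecidableEq n₂] [DecidableEq n₃]
    (ρ : Matrix (n₁ × n₂ × n₃) (n₁ × n₂ × n₃) ℂ) (ε : ℝ) :
    reduced12 (ρ + ε • (1 : Matrix (n₁ × n₂ × n₃) (n₁ × n₂ × n₃) ℂ)) =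
      reduced12 ρ + (ε * Fintype.card n₃) • (1 : Matrix (n₁ × n₂) (n₁ × n₂) ℂ) := by
  ext a b
  by_cases h : a = b
  · subst h
    simp [reduced12, Finset.sum_add_distrib, mul_comm]
  · have h' (k : n₃) : (a.1, a.2, k) ≠ (b.1, b.2, k) := by
      simpa [Prod.ext_iff] using h
    simp [reduced12, one_apply_ne, h, h']

theorem reduced23_add_smul_one [Fintype n₁]
    [DecidableEq n₁] [DecidableEq n₂] [DecidableEq n₃]
    (ρ : Matrix (n₁ × n₂ × n₃) (n₁ × n₂ × n₃) ℂ) (ε : ℝ) :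
    reduced23 (ρ + ε • (1 : Matrix (n₁ × n₂ × n₃) (n₁ × n₂ × n₃) ℂ)) =
      reduced23 ρ + (ε * Fintype.card n₁) • (1 : Matrix (n₂ × n₃) (n₂ × n₃) ℂ) := by
  ext a b
  by_cases h : a = b
  · subst h
    simp [reduced23, Finset.sum_add_distrib, mul_comm]
  · have h' (i : n₁) : (i, a) ≠ (i, b) := by
      simpa using h
    simp [reduced23, one_apply_ne, h, h']

theorem reduced2_add_smul_one [Fintype n₁] [Fintype n₃]
    [DecidableEq n₁] [DecidableEq n₂] [DecidableEq n₃]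
    (ρ : Matrix (n₁ × n₂ × n₃) (n₁ × n₂ × n₃) ℂ) (ε : ℝ) :
    reduced2 (ρ + ε • (1 : Matrix (n₁ × n₂ × n₃) (n₁ × n₂ × n₃) ℂ)) =
      reduced2 ρ + (ε * (Fintype.card n₁ * Fintype.card n₃)) • (1 : Matrix n₂ n₂ ℂ) := by
  ext a b
  by_cases h : a = b
  · subst h
    simp [reduced2, Finset.sum_add_distrib]
    ring
  · have h' (i : n₁) (k : n₃) : (i, a, k) ≠ (i, b, k) := by
      simpa using h
    simp [reduced2, one_apply_ne, h, h']

/-! ### Strong subadditivity of the von Neumann entropy -/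

theorem negMulQLog_one : negMulQLog 1 = Real.negMulLog := by
  funext x
  simp [negMulQLog, qLog, Real.negMulLog]

theorem mul_cfc_log {n : Type*} [Fintype n] [DecidableEq n] {A : Matrix n n ℂ}
    (hA : A.IsHermitian) : A * cfc Real.log A = -cfc Real.negMulLog A := by
  have hA' : IsSelfAdjoint A := hA
  have hfin : (spectrum ℝ A).Finite := by
    rw [hA.spectrum_real_eq_range_eigenvalues]
    exact Set.finite_range _
  have h := cfc_mul (fun x : ℝ => x) Real.log A (hfin.continuousOn _) (hfin.continuousOn _)
  rw [cfc_id' ℝ A] at h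
  rw [← h, ← cfc_neg]
  simp [Real.negMulLog]

theorem tsallisEntropy_one_eq_vonNeumannEntropy {n : Type*} [Fintype n] [DecidableEq n]
    {ρ : Matrix n n ℂ} (hρ : ρ.IsHermitian) : tsallisEntropy 1 ρ = vonNeumannEntropy ρ := by
  rw [tsallisEntropy, vonNeumannEntropy, mul_cfc_log hρ, negMulQLog_one, trace_neg,
    Complex.neg_re, neg_neg]

/-- If `σ` is the restriction of `ρ` along the embedding `φ`, the relative entropy of `ρ` with
respect to `φ σ` is therefore the difference `S(σ) - S(ρ)`. -/
theorem trace_mul_cfc_log_map {m n : Type*} [Fintype m] [DecidableEq m] [Fintype n]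
    [DecidableEq n] (φ : Matrix m m ℂ →⋆ₐ[ℂ] Matrix n n ℂ) {ρ : Matrix n n ℂ}
    {σ : Matrix m m ℂ} (hσ : σ.IsHermitian) (h : ∀ Y, (ρ * φ Y).trace = (σ * Y).trace) :
    (ρ * cfc Real.log (φ σ)).trace.re = -tsallisEntropy 1 σ := by
  rw [← map_cfc_of_isHermitian φ _ hσ, h, mul_cfc_log hσ, tsallisEntropy, negMulQLog_one,
    trace_neg, Complex.neg_re]

/-- Monotonicity of the relative entropy of `ρ₁₂₃` with respect to `1 ⊗ ρ₂₃` under the partial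
trace over the third factor is strong subadditivity. -/
theorem ssaInequality_one_of_posDef [Fintype n₁] [Fintype n₂] [Fintype n₃]
    [DecidableEq n₁] [DecidableEq n₂] [DecidableEq n₃]
    {ρ : Matrix (n₁ × n₂ × n₃) (n₁ × n₂ × n₃) ℂ}
    (hρ : ρ.PosDef) (h12 : (reduced12 ρ).PosDef) (h23 : (reduced23 ρ).PosDef)
    (h2 : (reduced2 ρ).PosDef) : SSAInequality 1 ρ := by
  have hσ : (oneKroneckerHom n₁ (n₂ × n₃) (reduced23 ρ)).PosDef := PosDef.one.kronecker h23
  have hσ' : (oneKroneckerHom n₁ n₂ (reduced2 ρ)).PosDef := PosDef.one.kronecker h2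
  have key := hρ.relativeEntropy_le hσ h12 hσ'
    ((reindexHom (Equiv.prodAssoc n₁ n₂ n₃)).comp (kroneckerOneHom (n₁ × n₂) n₃))
    (trace_reduced12_mul ρ) (trace_oneKroneckerHom_reduced23_mul ρ)
  rw [trace_mul_cfc_log_map _ h23.isHermitian (trace_reduced23_mul ρ),
    trace_mul_cfc_log_map _ h2.isHermitian (trace_reduced2_mul ρ), ← negMulQLog_one] at key
  change -tsallisEntropy 1 (reduced12 ρ) - _ ≤ -tsallisEntropy 1 ρ - _ at key
  unfold SSAInequality
  linarith

theorem ssaInequality_one [Fintype n₁] [Fintype n₂] [Fintype n₃]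
    [DecidableEq n₁] [DecidableEq n₂] [DecidableEq n₃]
    {ρ : Matrix (n₁ × n₂ × n₃) (n₁ × n₂ × n₃) ℂ}
    (hρ : ρ.PosSemidef) [Nonempty n₁] [Nonempty n₃] : SSAInequality 1 ρ := by
  have c1 : (0 : ℝ) < Fintype.card n₁ := by exact_mod_cast Fintype.card_pos
  have c3 : (0 : ℝ) < Fintype.card n₃ := by exact_mod_cast Fintype.card_pos
  have hcont : Continuous (negMulQLog 1) := negMulQLog_one ▸ Real.continuous_negMulLog
  have t123 := hρ.isHermitian.tendsto_trace_cfc_add_smul_one hcont 1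
  have t2 := hρ.reduced2.isHermitian.tendsto_trace_cfc_add_smul_one hcont
    (Fintype.card n₁ * Fintype.card n₃)
  have t12 := hρ.reduced12.isHermitian.tendsto_trace_cfc_add_smul_one hcont (Fintype.card n₃)
  have t23 := hρ.reduced23.isHermitian.tendsto_trace_cfc_add_smul_one hcont (Fintype.card n₁)
  refine le_of_tendsto_of_tendsto (t123.add t2) (t12.add t23) ?_
  filter_upwards [self_mem_nhdsWithin] with ε hε
  have hε' : (0 : ℝ) < ε := hε
  have h := ssaInequality_one_of_posDef (hρ.add_smul_one_posDef hε')
    (by rw [reduced12_add_smul_one]; exact hρ.reduced12.add_smul_one_posDef (by positivity))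
    (by rw [reduced23_add_smul_one]; exact hρ.reduced23.add_smul_one_posDef (by positivity))
    (by rw [reduced2_add_smul_one]; exact hρ.reduced2.add_smul_one_posDef (by positivity))
  rw [SSAInequality, reduced12_add_smul_one, reduced23_add_smul_one, reduced2_add_smul_one] at h
  rw [mul_one]
  exact h

end

/-! ### The functional calculus on Kronecker products and multiples of projections -/

namespace Matrix

open Polynomial in
theorem IsHermitian.trace_cfc_of_charpoly_eq {n ι : Type*} [Fintype n] [DecidableEq n] [Fintype ι]
    {A : Matrix n n ℂ} (hA : A.IsHermitian) {d : ι → ℝ}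
    (h : A.charpoly = ∏ i, (X - C (d i : ℂ))) (f : ℝ → ℝ) :
    (cfc f A).trace.re = ∑ i, f (d i) := by
  have h1 : A.charpoly.roots = Multiset.map (fun i => (d i : ℂ)) Finset.univ.val := by
    rw [h, Polynomial.roots_prod]
    · simp
    · simp [Finset.prod_ne_zero_iff, Polynomial.X_sub_C_ne_zero]
  have h2 := congrArg (fun s => (Multiset.map (fun z : ℂ => f z.re) s).sum)
    (hA.roots_charpoly_eq_eigenvalues.symm.trans h1)
  simp only [Multiset.map_map, Function.comp_def, Complex.coe_algebraMap, Complex.ofReal_re] at h2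
  rw [hA.trace_cfc, Complex.re_sum]
  exact h2

open Polynomial in
theorem IsHermitian.charpoly_kronecker {m n : Type*} [Fintype m] [DecidableEq m] [Fintype n]
    [DecidableEq n] {A : Matrix m m ℂ} {B : Matrix n n ℂ} (hA : A.IsHermitian)
    (hB : B.IsHermitian) :
    (A ⊗ₖ B).charpoly =
      ∏ p : m × n, (X - C ((hA.eigenvalues p.1 * hB.eigenvalues p.2 : ℝ) : ℂ)) := by
  conv_lhs => rw [hA.eq_mul_diagonal_mul, hB.eq_mul_diagonal_mul]
  rw [mul_kronecker_mul, mul_kronecker_mul, charpoly_mul_comm, ← Matrix.mul_assoc,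
    ← mul_kronecker_mul, hA.eigenvectorUnitary_conjTranspose_mul,
    hB.eigenvectorUnitary_conjTranspose_mul, one_kronecker_one, Matrix.one_mul,
    diagonal_kronecker_diagonal, charpoly_diagonal]
  simp

/-- On a multiple of a projection the functional calculus of a function vanishing at `0` is
multiplication by a scalar. -/
theorem IsHermitian.cfc_of_mul_self {n : Type*} [Fintype n] [DecidableEq n] {A : Matrix n n ℂ}
    (hA : A.IsHermitian) {c : ℝ} (hc : c ≠ 0) (h : A * A = c • A) {f : ℝ → ℝ} (hf : f 0 = 0) :
    cfc f A = (f c / c) • A := by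
  have hA' : IsSelfAdjoint A := hA
  have hspec : ∀ x ∈ spectrum ℝ A, x = 0 ∨ x = c := by
    intro x hx
    have hP : IsIdempotentElem (c⁻¹ • A) := by
      rw [IsIdempotentElem, smul_mul_smul_comm, h, smul_smul, mul_assoc, inv_mul_cancel₀ hc,
        mul_one]
    have hx' : c⁻¹ * x ∈ spectrum ℝ (c⁻¹ • A) :=
      (spectrum.smul_mem_smul_iff (r := Units.mk0 c⁻¹ (inv_ne_zero hc))).2 hx
    rcases hP.spectrum_subset ℝ hx' with h0 | h1
    · exact Or.inl ((mul_eq_zero.1 h0).resolve_left (inv_ne_zero hc))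
    · exact Or.inr ((inv_mul_eq_one₀ hc).1 h1).symm
  have heq : (spectrum ℝ A).EqOn f (fun x => f c / c * x) := by
    intro x hx
    rcases hspec x hx with rfl | rfl
    · simp [hf]
    · field_simp
  rw [cfc_congr heq, cfc_const_mul_id (f c / c) A]

end Matrix

open Matrix

/-! ### Pseudo-additivity and the failure for `q < 1` -/

theorem negMulQLog_zero (q : ℝ) : negMulQLog q 0 = 0 := by simp [negMulQLog]

theorem negMulQLog_mul (q : ℝ) {a b : ℝ} (ha : 0 ≤ a) (hb : 0 ≤ b) :
    negMulQLog q (a * b) = negMulQLog q a * b + a * negMulQLog q b +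
      (1 - q) * (negMulQLog q a * negMulQLog q b) := by
  rcases ha.eq_or_lt with rfl | ha'
  · simp [negMulQLog_zero]
  rcases hb.eq_or_lt with rfl | hb'
  · simp [negMulQLog_zero]
  -- strict positivity matters only for `q = 1`, where `log (a * b)` has to be split
  unfold negMulQLog qLog
  split_ifs with hq
  · rw [Real.log_mul ha'.ne' hb'.ne', hq]
    ring
  · have hq' : q - 1 ≠ 0 := sub_ne_zero.2 hq
    rw [Real.mul_rpow ha hb]
    field_simp
    ring

theorem tsallisEntropy_kronecker (q : ℝ) {m n : Type*} [Fintype m] [DecidableEq m] [Fintype n]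
    [DecidableEq n] {ρ : Matrix m m ℂ} {σ : Matrix n n ℂ} (hρ : IsDensityMatrix ρ)
    (hσ : IsDensityMatrix σ) :
    tsallisEntropy q (ρ ⊗ₖ σ) = tsallisEntropy q ρ + tsallisEntropy q σ +
      (1 - q) * tsallisEntropy q ρ * tsallisEntropy q σ := by
  have hρ1 := hρ.1.isHermitian
  have hσ1 := hσ.1.isHermitian
  have e1 : ∑ i, hρ1.eigenvalues i = 1 := by
    have h := hρ1.trace_eq_sum_eigenvalues
    rw [hρ.2] at h
    simpa using (congrArg Complex.re h).symm
  have e2 : ∑ i, hσ1.eigenvalues i = 1 := by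
    have h := hσ1.trace_eq_sum_eigenvalues
    rw [hσ.2] at h
    simpa using (congrArg Complex.re h).symm
  have s1 : tsallisEntropy q ρ = ∑ i, negMulQLog q (hρ1.eigenvalues i) := by
    rw [tsallisEntropy, hρ1.trace_cfc, Complex.re_sum]
    rfl
  have s2 : tsallisEntropy q σ = ∑ i, negMulQLog q (hσ1.eigenvalues i) := by
    rw [tsallisEntropy, hσ1.trace_cfc, Complex.re_sum]
    rfl
  have s3 : tsallisEntropy q (ρ ⊗ₖ σ) = ∑ i, ∑ j, (negMulQLog q (hρ1.eigenvalues i) *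
      hσ1.eigenvalues j + hρ1.eigenvalues i * negMulQLog q (hσ1.eigenvalues j) +
      (1 - q) * (negMulQLog q (hρ1.eigenvalues i) * negMulQLog q (hσ1.eigenvalues j))) := by
    rw [tsallisEntropy, (hρ.1.kronecker hσ.1).isHermitian.trace_cfc_of_charpoly_eq
      (hρ1.charpoly_kronecker hσ1), Fintype.sum_prod_type]
    exact Finset.sum_congr rfl fun i _ => Finset.sum_congr rfl fun j _ =>
      negMulQLog_mul q (hρ.1.eigenvalues_nonneg i) (hσ.1.eigenvalues_nonneg j)
  rw [s3]
  simp only [Finset.sum_add_distrib, ← Finset.mul_sum, ← Finset.sum_mul]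
  rw [← s1, ← s2, e1, e2]
  ring

theorem tsallisEntropy_of_mul_self (q : ℝ) {n : Type*} [Fintype n] [DecidableEq n]
    {ρ : Matrix n n ℂ} (hρ : ρ.IsHermitian) (htr : ρ.trace = 1) {c : ℝ} (hc : c ≠ 0)
    (h : ρ * ρ = c • ρ) : tsallisEntropy q ρ = -qLog q c := by
  rw [tsallisEntropy, hρ.cfc_of_mul_self hc h (negMulQLog_zero q), trace_smul, htr,
    Complex.real_smul, mul_one, Complex.ofReal_re, negMulQLog, neg_div, mul_div_cancel_left₀ _ hc]

theorem qLog_one (q : ℝ) : qLog q 1 = 0 := by simp [qLog]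

theorem qLog_half_ne_zero {q : ℝ} (hq : q ≠ 1) : qLog q (1 / 2) ≠ 0 := by
  rw [qLog, if_neg hq]
  refine div_ne_zero (sub_ne_zero.2 ?_) (sub_ne_zero.2 hq)
  rcases hq.lt_or_gt with h | h
  · exact (Real.one_lt_rpow_of_pos_of_lt_one_of_neg (by norm_num) (by norm_num)
      (by linarith)).ne'
  · exact (Real.rpow_lt_one (by norm_num) (by norm_num) (by linarith)).ne

/-- A Hermitian matrix with `ρ² = c ρ` and `c > 0` equals `c⁻¹ ρ* ρ`. -/
theorem isDensityMatrix_of_mul_self {n : Type*} [Fintype n]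
    {ρ : Matrix n n ℂ} (hρ : ρ.IsHermitian) (htr : ρ.trace = 1) {c : ℝ} (hc : 0 < c)
    (h : ρ * ρ = c • ρ) : IsDensityMatrix ρ := by
  have h' : ρ = c⁻¹ • (ρᴴ * ρ) := by
    rw [hρ.eq, h, smul_smul, inv_mul_cancel₀ hc.ne', one_smul]
  refine ⟨?_, htr⟩
  rw [h']
  exact (posSemidef_conjTranspose_mul_self ρ).smul (inv_pos.2 hc).le

theorem IsPureState.isDensityMatrix {n : Type*} [Fintype n] {ρ : Matrix n n ℂ}
    (hρ : IsPureState ρ) : IsDensityMatrix ρ := by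
  obtain ⟨ψ, hψ, rfl⟩ := hρ
  exact ⟨posSemidef_vecMulVec_self_star ψ, by rw [trace_vecMulVec, dotProduct_comm, hψ]⟩

theorem IsPureState.mul_self {n : Type*} [Fintype n] {ρ : Matrix n n ℂ}
    (hρ : IsPureState ρ) : ρ * ρ = ρ := by
  obtain ⟨ψ, hψ, rfl⟩ := hρ
  rw [vecMulVec_mul_vecMulVec, hψ, one_smul]

theorem IsPureState.tsallisEntropy_eq_zero {n : Type*} [Fintype n] [DecidableEq n]
    {ρ : Matrix n n ℂ} (hρ : IsPureState ρ) (q : ℝ) : tsallisEntropy q ρ = 0 := by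
  rw [tsallisEntropy_of_mul_self q hρ.isDensityMatrix.1.isHermitian hρ.isDensityMatrix.2
    one_ne_zero (by rw [hρ.mul_self, one_smul]), qLog_one, neg_zero]

/-- The maximally mixed state of a qubit. -/
noncomputable def mixedQubit : Matrix (Fin 2) (Fin 2) ℂ := (1 / 2 : ℝ) • 1

theorem mixedQubit_mul_self : mixedQubit * mixedQubit = (1 / 2 : ℝ) • mixedQubit := by
  rw [mixedQubit, smul_mul_assoc, Matrix.one_mul]

theorem trace_mixedQubit : mixedQubit.trace = 1 := by
  rw [mixedQubit, trace_smul, trace_one]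
  norm_num

theorem isHermitian_mixedQubit : mixedQubit.IsHermitian :=
  isHermitian_one.smul (IsSelfAdjoint.all _)

theorem isDensityMatrix_mixedQubit : IsDensityMatrix mixedQubit :=
  isDensityMatrix_of_mul_self isHermitian_mixedQubit trace_mixedQubit (by norm_num)
    mixedQubit_mul_self

theorem tsallisEntropy_mixedQubit (q : ℝ) : tsallisEntropy q mixedQubit = -qLog q (1 / 2) :=
  tsallisEntropy_of_mul_self q isHermitian_mixedQubit trace_mixedQubit (by norm_num)
    mixedQubit_mul_self

section

variable {n₁ n₂ n₃ : Type*}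

theorem reduced12_kronecker [Fintype n₃] (α : Matrix n₁ n₁ ℂ) (β : Matrix n₂ n₂ ℂ)
    {γ : Matrix n₃ n₃ ℂ} (hγ : γ.trace = 1) : reduced12 (α ⊗ₖ (β ⊗ₖ γ)) = α ⊗ₖ β := by
  ext a b
  change ∑ k, α a.1 b.1 * (β a.2 b.2 * γ k k) = α a.1 b.1 * β a.2 b.2
  rw [← Finset.mul_sum, ← Finset.mul_sum]
  change α a.1 b.1 * (β a.2 b.2 * γ.trace) = _
  rw [hγ, mul_one]

theorem reduced23_kronecker [Fintype n₁] {α : Matrix n₁ n₁ ℂ} (hα : α.trace = 1)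
    (τ : Matrix (n₂ × n₃) (n₂ × n₃) ℂ) : reduced23 (α ⊗ₖ τ) = τ := by
  ext a b
  change ∑ i, α i i * τ a b = τ a b
  rw [← Finset.sum_mul]
  change α.trace * τ a b = _
  rw [hα, one_mul]

theorem reduced2_kronecker [Fintype n₁] [Fintype n₃] {α : Matrix n₁ n₁ ℂ} (hα : α.trace = 1)
    (β : Matrix n₂ n₂ ℂ) {γ : Matrix n₃ n₃ ℂ} (hγ : γ.trace = 1) :
    reduced2 (α ⊗ₖ (β ⊗ₖ γ)) = β := by
  ext j j'
  change ∑ i, ∑ k, α i i * (β j j' * γ k k) = β j j'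
  simp only [← Finset.mul_sum, ← Finset.sum_mul]
  change α.trace * (β j j' * γ.trace) = _
  rw [hα, hγ, one_mul, mul_one]

end

theorem exists_not_ssaInequality_of_lt_one {q : ℝ} (hq : q < 1) :
    ∃ ρ₁ ρ₂ ρ₃ : Matrix (Fin 2) (Fin 2) ℂ,
      IsDensityMatrix ρ₁ ∧ IsDensityMatrix ρ₂ ∧ IsDensityMatrix ρ₃ ∧
      ¬ SSAInequality q (ρ₁ ⊗ₖ (ρ₂ ⊗ₖ ρ₃)) := by
  have hpure : IsPureState (vecMulVec (Pi.single 0 1) (star (Pi.single 0 1)) :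
      Matrix (Fin 2) (Fin 2) ℂ) := ⟨Pi.single 0 1, by simp, rfl⟩
  set P : Matrix (Fin 2) (Fin 2) ℂ := vecMulVec (Pi.single 0 1) (star (Pi.single 0 1))
  have hP := hpure.isDensityMatrix
  have hM := isDensityMatrix_mixedQubit
  have hPM : IsDensityMatrix (P ⊗ₖ mixedQubit) :=
    ⟨hP.1.kronecker hM.1, by rw [trace_kronecker, hP.2, hM.2, one_mul]⟩
  refine ⟨mixedQubit, P, mixedQubit, hM, hP, hM, ?_⟩
  -- the defect of the inequality is `(1 - q) S(ρ₁) S(ρ₃)`, as `ρ₂` has no entropy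
  rw [SSAInequality, reduced12_kronecker _ _ hM.2, reduced23_kronecker hM.2,
    reduced2_kronecker hM.2 _ hM.2, tsallisEntropy_kronecker q hM hPM,
    tsallisEntropy_kronecker q hP hM, tsallisEntropy_kronecker q hM hP,
    hpure.tsallisEntropy_eq_zero, tsallisEntropy_mixedQubit]
  have h : 0 < (1 - q) * (qLog q (1 / 2)) ^ 2 :=
    mul_pos (by linarith) (sq_pos_of_ne_zero (qLog_half_ne_zero hq.ne))
  intro hle
  nlinarith

/-! ### The pure entangled reduction and the failure for `q > 1` -/

theorem counterexampleState_mul_self :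
    counterexampleState * counterexampleState = (1 / 2 : ℝ) • counterexampleState := by
  ext ⟨i, j, k⟩ ⟨i', j', k'⟩
  fin_cases i <;> fin_cases j <;> fin_cases k <;> fin_cases i' <;> fin_cases j' <;>
    fin_cases k' <;>
    norm_num [mul_apply, Fintype.sum_prod_type, Fin.sum_univ_two, counterexampleState,
      tripleIndex]

theorem isHermitian_counterexampleState : counterexampleState.IsHermitian := by
  ext ⟨i, j, k⟩ ⟨i', j', k'⟩
  fin_cases i <;> fin_cases j <;> fin_cases k <;> fin_cases i' <;> fin_cases j' <;>
    fin_cases k' <;> simp [counterexampleState, tripleIndex]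

theorem trace_counterexampleState : counterexampleState.trace = 1 := by
  simp [trace, Fintype.sum_prod_type, Fin.sum_univ_two, counterexampleState, tripleIndex]
  norm_num

theorem reduced23_counterexampleState :
    reduced23 counterexampleState = mixedQubit ⊗ₖ mixedQubit := by
  ext ⟨j, k⟩ ⟨j', k'⟩
  fin_cases j <;> fin_cases k <;> fin_cases j' <;> fin_cases k' <;>
    norm_num [reduced23, Fin.sum_univ_two, counterexampleState, tripleIndex, mixedQubit]

theorem reduced2_counterexampleState : reduced2 counterexampleState = mixedQubit := by
  ext j j'
  fin_cases j <;> fin_cases j' <;>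
    norm_num [reduced2, Fin.sum_univ_two, counterexampleState, tripleIndex, mixedQubit]

/-- The reduced state is the projection onto `(e₀ ⊗ e₁ + e₁ ⊗ e₀) / √2`. -/
theorem isPureState_reduced12_counterexampleState :
    IsPureState (reduced12 counterexampleState) := by
  have h2 : ((√2 : ℝ) : ℂ)⁻¹ * ((√2 : ℝ) : ℂ)⁻¹ = 1 / 2 := by
    rw [← mul_inv, ← Complex.ofReal_mul, Real.mul_self_sqrt (by norm_num)]
    norm_num
  refine ⟨fun a => if a.1 = a.2 then 0 else ((√2 : ℝ) : ℂ)⁻¹, ?_, ?_⟩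
  · simp [dotProduct, Fintype.sum_prod_type, Fin.sum_univ_two, h2]
    norm_num
  · ext ⟨i, j⟩ ⟨i', j'⟩
    fin_cases i <;> fin_cases j <;> fin_cases i' <;> fin_cases j' <;>
      norm_num [reduced12, Fin.sum_univ_two, counterexampleState, tripleIndex, vecMulVec_apply, h2]

theorem not_ssaInequality_counterexampleState {q : ℝ} (hq : 1 < q) :
    ¬ SSAInequality q counterexampleState := by
  rw [SSAInequality, reduced23_counterexampleState, reduced2_counterexampleState,
    tsallisEntropy_kronecker q isDensityMatrix_mixedQubit isDensityMatrix_mixedQubit,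
    isPureState_reduced12_counterexampleState.tsallisEntropy_eq_zero, tsallisEntropy_mixedQubit,
    tsallisEntropy_of_mul_self q isHermitian_counterexampleState trace_counterexampleState
      (by norm_num) counterexampleState_mul_self]
  have h : 0 < (q - 1) * (qLog q (1 / 2)) ^ 2 :=
    mul_pos (by linarith) (sq_pos_of_ne_zero (qLog_half_ne_zero hq.ne'))
  intro hle
  nlinarith

/-- Nonnegativity of the principal `2 × 2` minors. -/
theorem Matrix.PosSemidef.norm_sq_apply_le {n : Type*} [Finite n] {A : Matrix n n ℂ}
    (hA : A.PosSemidef) (i j : n) : ‖A i j‖ ^ 2 ≤ (A i i).re * (A j j).re := by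
  have h := (hA.submatrix ![i, j]).det_nonneg
  have hji : A j i = star (A i j) := (hA.isHermitian.apply j i).symm
  have hi := hA.isHermitian.coe_re_apply_self i
  have hj := hA.isHermitian.coe_re_apply_self j
  simp only [det_fin_two, submatrix_apply, cons_val_zero, cons_val_one, hji, Complex.star_def,
    Complex.mul_conj, Complex.normSq_eq_norm_sq] at h
  rw [← hi, ← hj] at h
  have h' : 0 ≤ RCLike.re (A i i) * RCLike.re (A j j) - ‖A i j‖ ^ 2 :=
    Complex.zero_le_real.1 (by push_cast at h ⊢; exact h)
  exact sub_nonneg.1 h'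

/-- A half-space that contains all separable states. It bounds the real part of an off-diagonal
entry of the partial transpose by the diagonal entries. -/
theorem IsSeparableState.two_mul_re_le {m n : Type*} [Fintype m] [Fintype n]
    {σ : Matrix (m × n) (m × n) ℂ} (hσ : IsSeparableState σ) (i i' : m) (j j' : n) :
    2 * (σ (i, j') (i', j)).re ≤ (σ (i, j) (i, j)).re + (σ (i', j') (i', j')).re := by
  refine convexHull_min (t := {σ : Matrix (m × n) (m × n) ℂ | 2 * (σ (i, j') (i', j)).re ≤
    (σ (i, j) (i, j)).re + (σ (i', j') (i', j')).re}) ?_ ?_ hσ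
  · rintro _ ⟨α, β, ⟨hα, -⟩, ⟨hβ, -⟩, rfl⟩
    simp only [Set.mem_ofPred_eq, kronecker_apply]
    have h1 := hα.norm_sq_apply_le i i'
    have h2 := hβ.norm_sq_apply_le j' j
    have hαi := (Complex.le_def.1 (hα.diag_nonneg (i := i))).1
    have hαi' := (Complex.le_def.1 (hα.diag_nonneg (i := i'))).1
    have hβj := (Complex.le_def.1 (hβ.diag_nonneg (i := j))).1
    have hβj' := (Complex.le_def.1 (hβ.diag_nonneg (i := j'))).1
    rw [Complex.zero_re] at hαi hαi' hβj hβj'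
    have e1 : (α i i * β j j).re = (α i i).re * (β j j).re := by
      rw [← hα.isHermitian.coe_re_apply_self i]
      exact Complex.re_ofReal_mul _ _
    have e2 : (α i' i' * β j' j').re = (α i' i').re * (β j' j').re := by
      rw [← hα.isHermitian.coe_re_apply_self i']
      exact Complex.re_ofReal_mul _ _
    rw [e1, e2]
    have h3 : (α i i' * β j' j).re ≤ ‖α i i'‖ * ‖β j' j‖ :=
      (Complex.re_le_norm _).trans (norm_mul _ _).le
    have h4 := mul_le_mul h1 h2 (sq_nonneg _) (mul_nonneg hαi hαi')
    -- `4xy ≤ (x + y)²` with `x`, `y` the two diagonal entries of `α ⊗ β`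
    have h5 : (2 * (‖α i i'‖ * ‖β j' j‖)) ^ 2 ≤
        ((α i i).re * (β j j).re + (α i' i').re * (β j' j').re) ^ 2 := by
      nlinarith [sq_nonneg ((α i i).re * (β j j).re - (α i' i').re * (β j' j').re)]
    have h6 := (abs_le.1 (abs_le_of_sq_le_sq h5 (by positivity))).2
    linarith
  · intro x hx y hy a b ha hb hab
    simp only [Set.mem_ofPred_eq, Matrix.add_apply, Matrix.smul_apply, Complex.add_re,
      Complex.real_smul, Complex.re_ofReal_mul] at hx hy ⊢
    nlinarith [mul_le_mul_of_nonneg_left hx ha, mul_le_mul_of_nonneg_left hy hb]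

theorem isEntangledState_reduced12_counterexampleState :
    IsEntangledState (reduced12 counterexampleState) := by
  refine ⟨isPureState_reduced12_counterexampleState.isDensityMatrix, fun h => ?_⟩
  have h' := h.two_mul_re_le 0 1 0 1
  norm_num [reduced12, Fin.sum_univ_two, counterexampleState, tripleIndex] at h'

/-! ### Strong subadditivity singles out `q = 1` -/

theorem mainTheorem1 :
    -- the Tsallis entropy with `q = 1` is the von Neumann entropy
    (∀ (d : ℕ) (ρ : Matrix (Fin d) (Fin d) ℂ), IsDensityMatrix ρ →
      tsallisEntropy 1 ρ = vonNeumannEntropy ρ) ∧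
    -- strong subadditivity holds if and only if `q = 1`
    (∀ q : ℝ, 0 < q → (TsallisStronglySubadditive q ↔ q = 1)) ∧
    -- pseudo-additivity on product states
    (∀ q : ℝ, 0 < q → ∀ (d e : ℕ) (ρX : Matrix (Fin d) (Fin d) ℂ) (ρY : Matrix (Fin e) (Fin e) ℂ),
      IsDensityMatrix ρX → IsDensityMatrix ρY →
      tsallisEntropy q (ρX ⊗ₖ ρY) = tsallisEntropy q ρX + tsallisEntropy q ρY
        + (1 - q) * tsallisEntropy q ρX * tsallisEntropy q ρY) ∧
    -- for `0 < q < 1` strong subadditivity fails on a product state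
    (∀ q : ℝ, 0 < q → q < 1 → ∃ ρ₁ ρ₂ ρ₃ : Matrix (Fin 2) (Fin 2) ℂ,
      IsDensityMatrix ρ₁ ∧ IsDensityMatrix ρ₂ ∧ IsDensityMatrix ρ₃ ∧
      ¬ SSAInequality q (ρ₁ ⊗ₖ (ρ₂ ⊗ₖ ρ₃))) ∧
    -- for `q > 1` it fails on the explicit state, whose reduction `ρ₁₂` is pure and entangled
    (IsDensityMatrix counterexampleState ∧
      IsPureState (reduced12 counterexampleState) ∧
      IsEntangledState (reduced12 counterexampleState) ∧
      ∀ q : ℝ, 1 < q → ¬ SSAInequality q counterexampleState) := by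
  have hlt : ∀ q : ℝ, 0 < q → q < 1 → ∃ ρ₁ ρ₂ ρ₃ : Matrix (Fin 2) (Fin 2) ℂ,
      IsDensityMatrix ρ₁ ∧ IsDensityMatrix ρ₂ ∧ IsDensityMatrix ρ₃ ∧
      ¬ SSAInequality q (ρ₁ ⊗ₖ (ρ₂ ⊗ₖ ρ₃)) :=
    fun q _ hq => exists_not_ssaInequality_of_lt_one hq
  have hce : IsDensityMatrix counterexampleState :=
    isDensityMatrix_of_mul_self isHermitian_counterexampleState trace_counterexampleState
      (by norm_num) counterexampleState_mul_self
  refine ⟨fun d ρ hρ => tsallisEntropy_one_eq_vonNeumannEntropy hρ.1.isHermitian,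
    fun q hq => ⟨fun h => ?_, ?_⟩, fun q _ d e ρX ρY => tsallisEntropy_kronecker q, hlt,
    hce, isPureState_reduced12_counterexampleState, isEntangledState_reduced12_counterexampleState,
    fun q => not_ssaInequality_counterexampleState⟩
  · rcases lt_trichotomy q 1 with h1 | h1 | h1
    · obtain ⟨ρ₁, ρ₂, ρ₃, hρ₁, hρ₂, hρ₃, hn⟩ := hlt q hq h1
      refine absurd (h 2 2 2 _ ⟨hρ₁.1.kronecker (hρ₂.1.kronecker hρ₃.1), ?_⟩) hn
      rw [trace_kronecker, trace_kronecker, hρ₁.2, hρ₂.2, hρ₃.2, one_mul, one_mul]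
    · exact h1
    · exact absurd (h 2 2 2 _ hce) (not_ssaInequality_counterexampleState h1)
  · rintro rfl d₁ d₂ d₃ ρ hρ
    -- a matrix of trace one has a nonempty index set
    obtain ⟨⟨i, -, k⟩⟩ : Nonempty (Fin d₁ × Fin d₂ × Fin d₃) := by
      by_contra hempty
      rw [not_nonempty_iff] at hempty
      exact zero_ne_one ((trace_eq_zero_of_isEmpty ρ).symm.trans hρ.2)
    have : Nonempty (Fin d₁) := ⟨i⟩
    have : Nonempty (Fin d₃) := ⟨k⟩
    exact ssaInequality_one hρ.1
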